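/- Let $m\ge 0$ be an integer, let $\gamma_1,\dots,\gamma_m$ be distinct unit vectors in $\mathbb R^2$ and let $c_1,\dots,c_m$ be nonzero real numbers. Write $(x_1,x_2)^\perp=(-x_2,x_1)$ and $\mathcal X_u h(x)=\int_0^\infty h(x+tu)\,dt$. Identify a symmetric $2$-tensor $g=(g_{ij})$ on $\mathbb R^2$ with the vector $(g_{11},g_{12},g_{22})\in\mathbb R^3$, so that $u\odot v=\frac12(u\otimes v+v\otimes u)$ becomes $\left(u_1v_1,\frac12(u_1v_2+u_2v_1),u_2v_2\right)$ and $u^2=u\odot u$ becomes $(u_1^2,u_1u_2,u_2^2)$, and let $\cdot$ be the dot product of $\mathbb R^3$. For an open set $\Omega\subseteq\mathbb R^2$ let $C_c^2(S^2;\Omega)$ be the space of twice continuously differentiable symmetric $2$-tensor fields on $\mathbb R^2$ whose support is a compact subset of $\Omega$. The star transform of a field $f\in C_c^2(S^2;\Omega)$ is the function $\mathcal Sf:\mathbb R^2\to\mathbb R^3$, $$\mathcal S f=\sum_{i=1}^m c_i\,\mathcal X_{\gamma_i}\begin{bmatrix} f\cdot\gamma_i^2\\ f\cdot(\gamma_i\odot\gamma_i^\perp)\\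 f\cdot(\gamma_i^\perp)^2\end{bmatrix}.$$ The star transform is called symmetric if $m=2k$ for some integer $k\ge 0$ and, after a suitable reindexing, $\gamma_{i+k}=-\gamma_i$ and $c_{i+k}=c_i$ for all $i=1,\dots,k$. Let $\Omega\subseteq\mathbb R^2$ be a nonempty open set (for example the whole plane or an open disc). Then $\mathcal S$ is invertible on $C_c^2(S^2;\Omega)$, meaning that every $f\in C_c^2(S^2;\Omega)$ is uniquely determined by $\mathcal Sf$ (that is, $\mathcal S$ is injective on $C_c^2(S^2;\Omega)$), if and only if $\mathcal S$ is not symmetric. In particular, if $m$ is odd, then $\mathcal S$ is invertible on $C_c^2(S^2;\Omega)$. -/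

import Mathlib

noncomputable section

namespace StarTransform

/-- The Euclidean plane. -/
abbrev Plane : Type := EuclideanSpace ℝ (Fin 2)

/-- A field of `2 × 2` real matrices (2-tensors) on the plane. -/
abbrev TensorField : Type := Plane → Matrix (Fin 2) (Fin 2) ℝ

/-- The rotation `(x₁, x₂)^⊥ = (-x₂, x₁)`. -/
def perp (x : Plane) : Plane := !₂[-x 1, x 0]

/-- The tensor product `(u ⊗ v)ᵢⱼ = uᵢ vⱼ`. -/
def tensorProd (u v : Plane) : Matrix (Fin 2) (Fin 2) ℝ :=
  Matrix.of fun i j => u i * v j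

/-- The symmetrized tensor product `u ⊙ v = (u ⊗ v + v ⊗ u) / 2`. -/
def symProd (u v : Plane) : Matrix (Fin 2) (Fin 2) ℝ :=
  (1 / 2 : ℝ) • (tensorProd u v + tensorProd v u)

/-- The identification of a symmetric 2-tensor `g` with the vector `(g₁₁, g₁₂, g₂₂)`. -/
def toVec (g : Matrix (Fin 2) (Fin 2) ℝ) : Fin 3 → ℝ := ![g 0 0, g 0 1, g 1 1]

/-- The dot product in `ℝ³` of two symmetric 2-tensors, identified with vectors. -/
def tensorDot (g h : Matrix (Fin 2) (Fin 2) ℝ) : ℝ := toVec g ⬝ᵥ toVec h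

/-- `C_c^2(S²; Ω)`: the twice continuously differentiable symmetric 2-tensor fields whose support
is a compact subset of `Ω`. -/
def smoothFields (Ω : Set Plane) : Set TensorField :=
  {f | (∀ x, (f x).IsSymm) ∧ (∀ i j, ContDiff ℝ 2 fun x => f x i j) ∧
    HasCompactSupport f ∧ tsupport f ⊆ Ω}

/-- The divergent beam transform `𝒳_u h (x) = ∫_0^∞ h (x + t u) dt`. -/
def divergentBeam (u : Plane) (h : Plane → ℝ) (x : Plane) : ℝ :=
  ∫ t in Set.Ioi (0 : ℝ), h (x + t • u)

/-- The star transform with branch directions `γ i` and weights `c i`. -/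
def starTransform {m : ℕ} (γ : Fin m → Plane) (c : Fin m → ℝ) (f : TensorField) :
    Plane → Fin 3 → ℝ := fun x =>
  ∑ i, c i • ![divergentBeam (γ i) (fun y => tensorDot (f y) (symProd (γ i) (γ i))) x,
    divergentBeam (γ i) (fun y => tensorDot (f y) (symProd (γ i) (perp (γ i)))) x,
    divergentBeam (γ i) (fun y => tensorDot (f y) (symProd (perp (γ i)) (perp (γ i)))) x]

/-- The star transform is symmetric: `m = 2k` and, after reindexing the branches by two copies
of `{1, …, k}` through `e`, one has `γ_{i+k} = -γ_i` and `c_{i+k} = c_i`. -/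
def IsSymmetricStar {m : ℕ} (γ : Fin m → Plane) (c : Fin m → ℝ) : Prop :=
  ∃ k : ℕ, m = 2 * k ∧ ∃ e : Fin k ⊕ Fin k ≃ Fin m,
    ∀ i : Fin k, γ (e (Sum.inr i)) = -γ (e (Sum.inl i)) ∧
      c (e (Sum.inr i)) = c (e (Sum.inl i))

/-- The star transform is invertible on `C_c^2(S²; Ω)`: a field in this space is uniquely
determined by its star transform. -/
def IsInvertibleStar {m : ℕ} (γ : Fin m → Plane) (c : Fin m → ℝ) (Ω : Set Plane) : Prop :=
  Set.InjOn (starTransform γ c) (smoothFields Ω)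

end StarTransform

end

namespace StarTransform
open MeasureTheory
open scoped FourierTransform

/-! On the Fourier side `𝒳_u` is, away from `⟨u, ξ⟩ = 0`, multiplication by a constant times `1 /
⟨u, ξ⟩`. So the star transform has the matrix symbol `∑ c_i ⟨γ_i, ξ⟩⁻¹ A(γ_i)`, where `A(u)`
(`frameMatrix`) is invertible for `u ≠ 0` and even in `u`.

If the star is symmetric, opposite branches combine into integrals over full lines. Some nonzero `φ`
supported in `Ω` has zero integral along every line in the finitely many directions
(`exists_field_integral_line_eq_zero`), and `φ` times the identity tensor lies in the kernel.

If the star is not symmetric, some branch `γ_{i₀}` is not balanced by its opposite. The symbol then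
has a pole along `⟨γ_{i₀}, ξ⟩ = 0` whose residue is a nonzero multiple of `A(γ_{i₀})`. Hence its
determinant is nonzero on a dense set (`dense_det_symbol_ne_zero`), where the Fourier transform of a
kernel field must vanish; by continuity it vanishes everywhere.

A beam transform need not be integrable, so Fourier transforms are taken only after iterated
differences along the branches (`fourier_iterDiff_complexBeam`). -/

/-! ### Symmetric stars: a nonzero field in the kernel. -/

lemma integrable_ray {E : Type*} [NormedAddCommGroup E] {h : Plane → E} (hc : Continuous h)
    (hs : HasCompactSupport h) {u : Plane} (hu : u ≠ 0) (x : Plane) :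
    Integrable fun t : ℝ => h (x + t • u) := by
  have hcl : Topology.IsClosedEmbedding fun t : ℝ => x + t • u :=
    (Homeomorph.addLeft x).isClosedEmbedding.comp (isClosedEmbedding_smul_left hu)
  exact Continuous.integrable_of_hasCompactSupport (by fun_prop) (hs.comp_isClosedEmbedding hcl)

lemma eq_zero_of_periodic {h : Plane → ℝ} (hs : HasCompactSupport h) {u : Plane} (hu : u ≠ 0)
    (hper : Function.Periodic h u) : h = 0 := by
  by_contra hne
  obtain ⟨x, hx⟩ : ∃ x, h x ≠ 0 := by
    by_contra! hall
    exact hne (funext hall)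
  obtain ⟨R, hR⟩ := hs.isCompact.isBounded.exists_norm_le
  obtain ⟨n, hn⟩ := exists_nat_gt ((R + ‖x‖) / ‖u‖)
  have hu' : 0 < ‖u‖ := norm_pos_iff.2 hu
  rw [div_lt_iff₀ hu'] at hn
  have hxn : h (x + n • u) ≠ 0 := by rwa [hper.nsmul n x]
  have h1 := hR _ (subset_tsupport h hxn)
  have h2 : ‖n • u‖ ≤ ‖x + n • u‖ + ‖x‖ := by
    have := norm_sub_le (x + n • u) x
    rwa [add_sub_cancel_left] at this
  rw [← Nat.cast_smul_eq_nsmul ℝ, norm_smul, Real.norm_natCast] at h2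
  rw [← Nat.cast_smul_eq_nsmul ℝ] at h1
  linarith

/-- Passing from `φ` to `φ - φ(· + εu)` kills the integrals along `u`, by translation invariance,
and keeps those already zero along other directions. The shift has length `δ`, small enough to keep
the support in `Ω`. The difference is nonzero because a nonzero compactly supported function has no
period. -/
lemma exists_field_integral_line_eq_zero {Ω : Set Plane} (hΩ : IsOpen Ω) (hne : Ω.Nonempty)
    (L : List Plane) (hL : ∀ u ∈ L, u ≠ 0) :
    ∃ φ : Plane → ℝ, ContDiff ℝ 2 φ ∧ HasCompactSupport φ ∧ tsupport φ ⊆ Ω ∧ φ ≠ 0 ∧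
      ∀ u ∈ L, ∀ x, ∫ t : ℝ, φ (x + t • u) = 0 := by
  induction L with
  | nil =>
    obtain ⟨x, hx⟩ := hne
    obtain ⟨φ, h1, h2, h3, -, h5⟩ := exists_contDiff_tsupport_subset (n := 2) (hΩ.mem_nhds hx)
    refine ⟨φ, h3, h2, h1, fun h => ?_, by simp⟩
    simp [h] at h5
  | cons u L ih =>
    obtain ⟨φ, hd, hs, hsub, hne, hz⟩ := ih fun v hv => hL v (List.mem_cons_of_mem _ hv)
    have hu : u ≠ 0 := hL u List.mem_cons_self
    obtain ⟨δ, hδ, hδΩ⟩ := hs.isCompact.exists_cthickening_subset_open hΩ hsub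
    set ε : ℝ := δ / ‖u‖ with hε
    have hu' : 0 < ‖u‖ := norm_pos_iff.2 hu
    have hε0 : 0 < ε := div_pos hδ hu'
    set ψ : Plane → ℝ := fun x => φ x - φ (x + ε • u) with hψ
    have hcomp : IsCompact (Metric.cthickening δ (tsupport φ)) := hs.isCompact.cthickening
    have hsupp : Function.support ψ ⊆ Metric.cthickening δ (tsupport φ) := by
      intro x hx
      by_cases h0 : φ x = 0
      · have h1 : φ (x + ε • u) ≠ 0 := by
          intro h1
          exact hx (by simp [hψ, h0, h1])
        refine Metric.mem_cthickening_of_dist_le x (x + ε • u) δ _ (subset_tsupport φ h1) ?_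
        rw [dist_self_add_right, norm_smul, Real.norm_of_nonneg hε0.le, hε,
          div_mul_cancel₀ _ hu'.ne']
      · exact Metric.self_subset_cthickening _ (subset_tsupport φ h0)
    have hts : tsupport ψ ⊆ Metric.cthickening δ (tsupport φ) :=
      closure_minimal hsupp Metric.isClosed_cthickening
    have hψs : HasCompactSupport ψ := HasCompactSupport.of_support_subset_isCompact hcomp hsupp
    refine ⟨ψ, ?_, hψs, hts.trans hδΩ, ?_, ?_⟩
    · exact hd.sub (hd.comp (contDiff_id.add contDiff_const))
    · intro h0
      refine hne (eq_zero_of_periodic hs (smul_ne_zero hε0.ne' hu) fun x => ?_)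
      have := congrFun h0 x
      simp only [hψ, Pi.zero_apply] at this
      linarith
    · intro v hv x
      have hint := fun y => integrable_ray hd.continuous hs (hL v hv) y
      have hsum : ∫ t : ℝ, ψ (x + t • v) =
          (∫ t : ℝ, φ (x + t • v)) - ∫ t : ℝ, φ (x + ε • u + t • v) := by
        rw [← integral_sub (hint _) (hint _)]
        simp only [hψ, add_right_comm]
      rw [hsum]
      rcases List.mem_cons.1 hv with rfl | hv
      · rw [sub_eq_zero, ← integral_add_right_eq_self _ ε]
        refine integral_congr_ae (.of_forall fun t => ?_)
        simp only [add_smul]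
        congr 1
        abel
      · rw [hz v hv, hz v hv, sub_zero]

lemma divergentBeam_add_neg {h : Plane → ℝ} (hc : Continuous h) (hs : HasCompactSupport h)
    {u : Plane} (hu : u ≠ 0) (x : Plane) :
    divergentBeam u h x + divergentBeam (-u) h x = ∫ t : ℝ, h (x + t • u) := by
  have hint := integrable_ray hc hs hu x
  rw [← intervalIntegral.integral_Iic_add_Ioi (b := 0) hint.integrableOn hint.integrableOn,
    add_comm]
  congr 1
  have := integral_comp_neg_Ioi 0 fun t : ℝ => h (x + t • u)
  rw [neg_zero] at this
  rw [← this]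
  simp [divergentBeam]

lemma perp_neg (u : Plane) : perp (-u) = -perp u := by
  ext i
  fin_cases i <;> simp [perp]

lemma symProd_neg_neg (u v : Plane) : symProd (-u) (-v) = symProd u v := by
  ext i j
  simp [symProd, tensorProd]

lemma divergentBeam_mul_const (u : Plane) (h : Plane → ℝ) (a : ℝ) (x : Plane) :
    divergentBeam u (fun y => h y * a) x = divergentBeam u h x * a :=
  integral_mul_const _ _

lemma tensorDot_smul_left (a : ℝ) (g h : Matrix (Fin 2) (Fin 2) ℝ) :
    tensorDot (a • g) h = a * tensorDot g h := by
  simp [tensorDot, toVec, dotProduct, Fin.sum_univ_three]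
  ring

/-- For `f = φ • 1` the tensor components are constants times `φ`, and these constants agree for `u`
and `-u`. Each opposite pair thus contributes a multiple of a full line integral of `φ`, which is
zero. -/
lemma not_isInvertibleStar_of_isSymmetricStar {m : ℕ} {γ : Fin m → Plane} {c : Fin m → ℝ}
    (hγ : ∀ i, γ i ≠ 0) {Ω : Set Plane} (hΩ : IsOpen Ω) (hne : Ω.Nonempty)
    (hsym : IsSymmetricStar γ c) : ¬ IsInvertibleStar γ c Ω := by
  intro hinv
  obtain ⟨φ, hd, hs, hsub, hφ, hz⟩ := exists_field_integral_line_eq_zero hΩ hne (List.ofFn γ)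
    (by simpa [List.forall_mem_ofFn_iff] using hγ)
  have hz' : ∀ i x, ∫ t : ℝ, φ (x + t • γ i) = 0 := fun i => hz _ (by simp)
  set f : TensorField := fun x => φ x • (1 : Matrix (Fin 2) (Fin 2) ℝ) with hf
  have hfs : Function.support f ⊆ Function.support φ := by
    intro x hx h0
    exact hx (by simp [hf, h0])
  have hfmem : f ∈ smoothFields Ω := by
    refine ⟨fun x => ?_, fun i j => ?_, hs.mono hfs, (closure_mono hfs).trans hsub⟩
    · simp [hf, Matrix.IsSymm]
    · simpa [hf] using hd.mul contDiff_const
  have h0mem : (0 : TensorField) ∈ smoothFields Ω := by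
    refine ⟨fun x => by simp [Matrix.IsSymm], fun i j => ?_, HasCompactSupport.zero, ?_⟩
    · simpa using contDiff_const
    · simp [tsupport]
  have h0S : starTransform γ c 0 = 0 := by
    funext x r
    have : ∀ B, tensorDot 0 B = 0 := fun B => by simp [tensorDot, toVec]
    fin_cases r <;> simp [starTransform, this, divergentBeam]
  have hfS : starTransform γ c f = 0 := by
    obtain ⟨k, -, e, he⟩ := hsym
    funext x
    rw [starTransform, ← e.sum_comp, Fintype.sum_sum_type, ← Finset.sum_add_distrib]
    refine Finset.sum_eq_zero fun i _ => ?_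
    have hopp : divergentBeam (-γ (e (Sum.inl i))) φ x = -divergentBeam (γ (e (Sum.inl i))) φ x := by
      have := divergentBeam_add_neg hd.continuous hs (hγ (e (Sum.inl i))) x
      rw [hz'] at this
      linarith
    rw [(he i).1, (he i).2, perp_neg]
    simp only [hf, tensorDot_smul_left, divergentBeam_mul_const, symProd_neg_neg, hopp]
    ext r
    fin_cases r <;> simp
  have := hinv hfmem h0mem (hfS.trans h0S.symm)
  refine hφ (funext fun x => ?_)
  simpa [hf] using congrFun (congrFun (congrFun this x) 0) 0

/-! ### Iterated differences and the Fourier transform. -/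

/-- The iterated finite difference of `g` with steps the members of `L`. -/
def iterDiff (L : List Plane) (g : Plane → ℂ) : Plane → ℂ :=
  match L with
  | [] => g
  | v :: L => fun x => iterDiff L g x - iterDiff L g (x + v)

/-- The multiplier of the translation by `v` under the Fourier transform. -/
noncomputable def shiftSymbol (ξ v : Plane) : ℂ := Complex.exp (↑(2 * Real.pi * inner ℝ v ξ) * Complex.I)

lemma fourier_translate (h : Plane → ℂ) (ξ v : Plane) :
    𝓕 (fun x => h (x + v)) ξ = shiftSymbol ξ v * 𝓕 h ξ := by
  rw [Real.fourier_eq', Real.fourier_eq', shiftSymbol, ← integral_const_mul]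
  rw [← integral_add_right_eq_self (fun x : Plane =>
    _ * (Complex.exp (↑(-2 * Real.pi * inner ℝ x ξ) * Complex.I) • h x)) v]
  refine integral_congr_ae (.of_forall fun x => ?_)
  simp only [smul_eq_mul, ← mul_assoc, ← Complex.exp_add, inner_add_left]
  congr 2
  push_cast
  ring

lemma fourier_sub {f g : Plane → ℂ} (hf : Integrable f) (hg : Integrable g) (ξ : Plane) :
    𝓕 (fun x => f x - g x) ξ = 𝓕 f ξ - 𝓕 g ξ := by
  have h := fun (f : Plane → ℂ) (hf : Integrable f) =>
    (VectorFourier.fourierIntegral_convergent_iff Real.continuous_fourierChar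
      (L := innerₗ Plane) continuous_inner ξ).2 hf
  simp only [Real.fourier_eq, smul_sub]
  exact integral_sub (h f hf) (h g hg)

lemma iterDiff_sum {ι : Type*} (s : Finset ι) (L : List Plane) (a : ι → ℂ) (g : ι → Plane → ℂ)
    (x : Plane) :
    iterDiff L (fun y => ∑ i ∈ s, a i * g i y) x = ∑ i ∈ s, a i * iterDiff L (g i) x := by
  induction L generalizing x with
  | nil => rfl
  | cons v L ih => simp only [iterDiff, ih, ← Finset.sum_sub_distrib, mul_sub]

lemma iterDiff_sub_translate (L : List Plane) (g : Plane → ℂ) (v x : Plane) :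
    iterDiff L (fun y => g y - g (y + v)) x = iterDiff L g x - iterDiff L g (x + v) := by
  induction L generalizing x with
  | nil => rfl
  | cons u L ih =>
    simp only [iterDiff, ih, add_right_comm x u v]
    ring

lemma iterDiff_zero (L : List Plane) (x : Plane) : iterDiff L (fun _ => 0) x = 0 := by
  induction L generalizing x with
  | nil => rfl
  | cons u L ih => simp [iterDiff, ih]

lemma integrable_iterDiff (L : List Plane) {g : Plane → ℂ} (hg : Integrable g) :
    Integrable (iterDiff L g) := by
  induction L with
  | nil => exact hg
  | cons u L ih => exact ih.sub (ih.comp_add_right u)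

lemma fourier_iterDiff (L : List Plane) {g : Plane → ℂ} (hg : Integrable g) (ξ : Plane) :
    𝓕 (iterDiff L g) ξ = (L.map fun v => 1 - shiftSymbol ξ v).prod * 𝓕 g ξ := by
  induction L with
  | nil => simp [iterDiff]
  | cons u L ih =>
    have hi := integrable_iterDiff L hg
    rw [List.map_cons, List.prod_cons]
    change 𝓕 (fun x => iterDiff L g x - iterDiff L g (x + u)) ξ = _
    rw [fourier_sub hi (hi.comp_add_right u), fourier_translate, ih]
    ring

/-- If the difference of `g` with a step from `L` is integrable, so is the iterated difference,
and its Fourier transform is the expected one. -/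
lemma fourier_iterDiff_of_mem (L : List Plane) {g w : Plane → ℂ} (hw : Integrable w) {v : Plane}
    (hgw : ∀ x, g x - g (x + v) = w x) (hv : v ∈ L) (ξ : Plane) :
    Integrable (iterDiff L g) ∧ (1 - shiftSymbol ξ v) * 𝓕 (iterDiff L g) ξ =
      (L.map fun u => 1 - shiftSymbol ξ u).prod * 𝓕 w ξ := by
  have hw' : w = fun y => g y - g (y + v) := funext fun x => (hgw x).symm
  induction L with
  | nil => simp at hv
  | cons u L ih =>
    by_cases huv : u = v
    · subst huv
      -- Differences commute, so the step `u` can be applied first, turning `g` into the integrable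
      -- `w`.
      have : iterDiff (u :: L) g = iterDiff L w := by
        funext x
        rw [hw', iterDiff_sub_translate, iterDiff]
      rw [this, fourier_iterDiff L hw]
      refine ⟨integrable_iterDiff L hw, ?_⟩
      rw [List.map_cons, List.prod_cons]
      ring
    · obtain ⟨h1, h2⟩ := ih ((List.mem_cons.1 hv).resolve_left fun h => huv h.symm)
      refine ⟨h1.sub (h1.comp_add_right u), ?_⟩
      change _ * 𝓕 (fun x => iterDiff L g x - iterDiff L g (x + u)) ξ = _
      rw [fourier_sub h1 (h1.comp_add_right u), fourier_translate, List.map_cons, List.prod_cons,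
        mul_assoc, ← h2]
      ring

/-! ### The Fourier multiplier of a differenced beam transform. -/

/-- The divergent beam transform of a complex-valued function. -/
noncomputable def complexBeam (u : Plane) (h : Plane → ℂ) (x : Plane) : ℂ :=
  ∫ t in Set.Ioi (0 : ℝ), h (x + t • u)

/-- One difference along the beam cuts the half-line to a segment, which restores integrability over
the plane. -/
lemma complexBeam_sub_translate {h : Plane → ℂ} (hc : Continuous h) (hs : HasCompactSupport h)
    {u : Plane} (hu : u ≠ 0) {s : ℝ} (hs0 : 0 ≤ s) (x : Plane) :
    complexBeam u h x - complexBeam u h (x + s • u) = ∫ t in Set.Ioc 0 s, h (x + t • u) := by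
  have hint := integrable_ray hc hs hu x
  have h1 : complexBeam u h (x + s • u) = ∫ t in Set.Ioi s, h (x + t • u) := by
    have hmp := (measurePreserving_add_right volume s).setIntegral_preimage_emb
      (measurableEmbedding_addRight s) (fun t : ℝ => h (x + t • u)) (Set.Ioi s)
    rw [Set.preimage_add_const_Ioi, sub_self] at hmp
    rw [← hmp, complexBeam]
    refine setIntegral_congr_fun measurableSet_Ioi fun t _ => ?_
    simp only [add_smul]
    congr 1
    abel
  rw [h1, complexBeam, ← Set.Ioc_union_Ioi_eq_Ioi hs0, setIntegral_union
    (Set.Ioc_disjoint_Ioi le_rfl) measurableSet_Ioi hint.integrableOn hint.integrableOn,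
    add_sub_cancel_right]

lemma integrable_prod_translate {h : Plane → ℂ} (hc : Continuous h) (hi : Integrable h)
    (u : Plane) (s : ℝ) :
    Integrable (fun p : Plane × ℝ => h (p.1 + p.2 • u))
      (volume.prod (volume.restrict (Set.Ioc 0 s))) := by
  rw [integrable_prod_iff']
  · refine ⟨.of_forall fun t => hi.comp_add_right (t • u), ?_⟩
    have : ∀ t : ℝ, ∫ x, ‖h (x + t • u)‖ = ∫ x, ‖h x‖ := fun t =>
      integral_add_right_eq_self (fun x => ‖h x‖) (t • u)
    simp only [this]
    exact integrable_const _
  · exact Continuous.aestronglyMeasurable (by fun_prop)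

/-- By Fubini this is the integral over `t` of the multipliers of the translations by `t • u`, an
elementary exponential integral. -/
lemma fourier_segment {h : Plane → ℂ} (hc : Continuous h) (hi : Integrable h) (u ξ : Plane)
    {s : ℝ} (hs0 : 0 ≤ s) (hu : inner ℝ u ξ ≠ 0) :
    𝓕 (fun x => ∫ t in Set.Ioc 0 s, h (x + t • u)) ξ =
      (shiftSymbol ξ (s • u) - 1) / (2 * Real.pi * inner ℝ u ξ * Complex.I : ℂ) * 𝓕 h ξ := by
  have hp := integrable_prod_translate hc hi u s
  have hp' : Integrable (Function.uncurry fun (x : Plane) (t : ℝ) =>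
      Complex.exp (↑(-2 * Real.pi * inner ℝ x ξ) * Complex.I) • h (x + t • u))
      (volume.prod (volume.restrict (Set.Ioc 0 s))) := by
    refine (hp.bdd_mul (c := 1) (f := fun p : Plane × ℝ =>
      Complex.exp (↑(-2 * Real.pi * inner ℝ p.1 ξ) * Complex.I)) ?_ ?_)
    · exact Continuous.aestronglyMeasurable (by fun_prop)
    · exact .of_forall fun p => (Complex.norm_exp_ofReal_mul_I _).le
  have hne : (2 * Real.pi * inner ℝ u ξ * Complex.I : ℂ) ≠ 0 := by
    have : (inner ℝ u ξ : ℂ) ≠ 0 := by exact_mod_cast hu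
    simp [Real.pi_ne_zero, this]
  rw [Real.fourier_eq']
  simp only [← integral_smul]
  rw [integral_integral_swap hp']
  have h1 : ∀ t : ℝ, ∫ x : Plane, Complex.exp (↑(-2 * Real.pi * inner ℝ x ξ) * Complex.I) •
      h (x + t • u) = Complex.exp ((2 * Real.pi * inner ℝ u ξ * Complex.I : ℂ) * t) * 𝓕 h ξ := by
    intro t
    rw [← Real.fourier_eq' (fun x => h (x + t • u)), fourier_translate, shiftSymbol,
      real_inner_smul_left]
    congr 2
    push_cast
    ring
  simp only [h1]
  rw [integral_mul_const, ← intervalIntegral.integral_of_le hs0, integral_exp_mul_complex hne,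
    shiftSymbol, real_inner_smul_left]
  simp only [Complex.ofReal_zero, mul_zero, Complex.exp_zero]
  congr 4
  push_cast
  ring

/-- The factor coming from `L` does not depend on `u`. With one list containing a step along each
branch, it is common to all terms of the star transform and can be cancelled. -/
lemma fourier_iterDiff_complexBeam (L : List Plane) {h : Plane → ℂ} (hc : Continuous h)
    (hs : HasCompactSupport h) {u ξ : Plane} {s : ℝ} (hs0 : 0 ≤ s) (hmem : s • u ∈ L)
    (hu : inner ℝ u ξ ≠ 0) (hsym : shiftSymbol ξ (s • u) ≠ 1) :
    Integrable (iterDiff L (complexBeam u h)) ∧ 𝓕 (iterDiff L (complexBeam u h)) ξ =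
      -(L.map fun v => 1 - shiftSymbol ξ v).prod / (2 * Real.pi * Complex.I) *
        ((inner ℝ u ξ : ℝ) : ℂ)⁻¹ * 𝓕 h ξ := by
  have hu0 : u ≠ 0 := by
    rintro rfl
    simp at hu
  have hi := hc.integrable_of_hasCompactSupport (μ := volume) hs
  have hw := (integrable_prod_translate hc hi u s).integral_prod_left
  obtain ⟨h1, h2⟩ := fourier_iterDiff_of_mem L hw
    (complexBeam_sub_translate hc hs hu0 hs0) hmem ξ
  refine ⟨h1, ?_⟩
  rw [fourier_segment hc hi u ξ hs0 hu] at h2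
  have h3 : 1 - shiftSymbol ξ (s • u) ≠ 0 := sub_ne_zero.2 hsym.symm
  have h4 : (inner ℝ u ξ : ℂ) ≠ 0 := by exact_mod_cast hu
  have h5 : (Real.pi : ℂ) ≠ 0 := by exact_mod_cast Real.pi_ne_zero
  refine mul_left_cancel₀ h3 (h2.trans ?_)
  field_simp
  ring

/-! ### The matrix symbol and its generic invertibility. -/

/-- The matrix of `g ↦ (g · u², g · (u ⊙ u^⊥), g · (u^⊥)²)`. -/
noncomputable def frameMatrix (u : Plane) : Matrix (Fin 3) (Fin 3) ℝ :=
  Matrix.of ![toVec (symProd u u), toVec (symProd u (perp u)), toVec (symProd (perp u) (perp u))]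

lemma inner_eq (u v : Plane) : inner ℝ u v = u 0 * v 0 + u 1 * v 1 := by
  simp [PiLp.inner_apply, Fin.sum_univ_two]
  ring

lemma det_frameMatrix (u : Plane) : (frameMatrix u).det = (u 0 ^ 2 + u 1 ^ 2) ^ 3 / 2 := by
  simp [frameMatrix, Matrix.det_fin_three, toVec, symProd, tensorProd, perp]
  ring

lemma frameMatrix_neg (u : Plane) : frameMatrix (-u) = frameMatrix u := by
  ext i j
  fin_cases i <;> fin_cases j <;> simp [frameMatrix, toVec, symProd, tensorProd, perp]

lemma sq_add_sq_of_norm_eq_one {u : Plane} (hu : ‖u‖ = 1) : u 0 ^ 2 + u 1 ^ 2 = 1 := by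
  have := real_inner_self_eq_norm_sq u
  rw [inner_eq, hu] at this
  linarith

lemma eq_or_eq_neg_of_inner_perp_eq_zero {u v : Plane} (hu : ‖u‖ = 1) (hv : ‖v‖ = 1)
    (h : inner ℝ u (perp v) = 0) : u = v ∨ u = -v := by
  have hu' := sq_add_sq_of_norm_eq_one hu
  have hv' := sq_add_sq_of_norm_eq_one hv
  have h' : u 1 * v 0 = u 0 * v 1 := by
    simp [inner_eq, perp] at h
    linarith
  set a := u 0 * v 0 + u 1 * v 1 with ha
  have h0 : u 0 = a * v 0 := by
    rw [ha]
    linear_combination (-u 0) * hv' - v 1 * h'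
  have h1 : u 1 = a * v 1 := by
    rw [ha]
    linear_combination (-u 1) * hv' + v 0 * h'
  have ha2 : a ^ 2 = 1 := by
    rw [h0, h1] at hu'
    linear_combination hu' - a ^ 2 * hv'
  rcases sq_eq_sq_iff_eq_or_eq_neg.1 (ha2.trans (one_pow 2).symm) with ha | ha
  · left
    ext i
    fin_cases i <;> simp [h0, h1, ha]
  · right
    ext i
    fin_cases i <;> simp [h0, h1, ha]

lemma isSymmetricStar_of_forall_exists_neg {m : ℕ} {γ : Fin m → Plane} {c : Fin m → ℝ}
    (hγ : ∀ i, ‖γ i‖ = 1) (hinj : Function.Injective γ)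
    (h : ∀ i, ∃ j, γ j = -γ i ∧ c j = c i) : IsSymmetricStar γ c := by
  classical
  choose σ hσ hσc using h
  have hσσ : ∀ i, σ (σ i) = i := fun i => hinj (by rw [hσ, hσ, neg_neg])
  -- A half-plane containing exactly one vector of each antipodal pair: its members index the first
  -- copy of `{1, …, k}`.
  let H : Fin m → Prop := fun i => 0 < γ i 0 ∨ γ i 0 = 0 ∧ 0 < γ i 1
  have hH : ∀ i, H (σ i) ↔ ¬ H i := by
    intro i
    have hn := sq_add_sq_of_norm_eq_one (hγ i)
    simp only [H, hσ, PiLp.neg_apply]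
    rcases lt_trichotomy (γ i 0) 0 with h0 | h0 | h0
    · simp [h0, h0.ne, h0.not_gt]
    · rcases lt_trichotomy (γ i 1) 0 with h1 | h1 | h1
      · simp [h0, h1, h1.le]
      · simp [h0, h1] at hn
      · simp [h0, h1, h1.le]
    · simp [h0, h0.ne', h0.not_gt]
  let τ : {i // H i} ≃ {i // ¬ H i} :=
    { toFun := fun i => ⟨σ i, fun h => (hH i).1 h i.2⟩
      invFun := fun i => ⟨σ i, (hH i).2 i.2⟩
      left_inv := fun i => Subtype.ext (hσσ i)
      right_inv := fun i => Subtype.ext (hσσ i) }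
  let ε : Fin (Fintype.card {i // H i}) ≃ {i // H i} := (Fintype.equivFin _).symm
  let e := (Equiv.sumCongr ε (ε.trans τ)).trans (Equiv.sumCompl H)
  refine ⟨_, ?_, e, fun i => ⟨hσ _, hσc _⟩⟩
  have := Fintype.card_congr e
  simp only [Fintype.card_sum, Fintype.card_fin] at this
  omega

lemma dense_ne_zero_of_analyticOnNhd {P : Plane → ℝ} (hP : AnalyticOnNhd ℝ P Set.univ)
    {ξ₀ : Plane} (h0 : P ξ₀ ≠ 0) : Dense {ξ | P ξ ≠ 0} := by
  intro ξ
  by_contra hξ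
  have hev : P =ᶠ[nhds ξ] 0 := by
    filter_upwards [isClosed_closure.isOpen_compl.mem_nhds hξ] with η hη
    by_contra h
    exact hη (subset_closure h)
  exact h0 (hP.eqOn_zero_of_preconnected_of_eventuallyEq_zero isPreconnected_univ
    (Set.mem_univ ξ) hev (Set.mem_univ ξ₀))

/-- This is the residue coefficient at `⟨γ_{i₀}, ξ⟩ = 0`. Only `±γ_{i₀}` are parallel to `γ_{i₀}`,
so the sum is `c_{i₀}`, or `c_{i₀} - c_j` when `γ_j = -γ_{i₀}` is present with `c_j ≠ c_{i₀}`. -/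
lemma sum_parallel_ne_zero {m : ℕ} {γ : Fin m → Plane} {c : Fin m → ℝ}
    (hγ : ∀ i, ‖γ i‖ = 1) (hinj : Function.Injective γ) (hc : ∀ i, c i ≠ 0) {i₀ : Fin m}
    (hi₀ : ¬ ∃ j, γ j = -γ i₀ ∧ c j = c i₀) :
    ∑ i with inner ℝ (γ i) (perp (γ i₀)) = 0, c i * inner ℝ (γ i) (γ i₀) ≠ 0 := by
  have hself : inner ℝ (γ i₀) (perp (γ i₀)) = 0 := by
    simp [inner_eq, perp]
    ring
  have h1 : inner ℝ (γ i₀) (γ i₀) = (1 : ℝ) := by rw [real_inner_self_eq_norm_sq, hγ]; norm_num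
  by_cases hj : ∃ j, γ j = -γ i₀
  · obtain ⟨j, hj⟩ := hj
    have hij : i₀ ≠ j := by
      rintro rfl
      have h2 : inner ℝ (γ i₀) (γ i₀) = -(1 : ℝ) := by
        nth_rw 1 [hj]
        rw [inner_neg_left, h1]
      linarith
    have hset : ({i | inner ℝ (γ i) (perp (γ i₀)) = 0} : Finset (Fin m)) = {i₀, j} := by
      ext i
      simp only [Finset.mem_filter, Finset.mem_univ, true_and, Finset.mem_insert,
        Finset.mem_singleton]
      constructor
      · intro h
        rcases eq_or_eq_neg_of_inner_perp_eq_zero (hγ i) (hγ i₀) h with h | h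
        · exact Or.inl (hinj h)
        · exact Or.inr (hinj (h.trans hj.symm))
      · rintro (rfl | rfl)
        · exact hself
        · rw [hj, inner_neg_left, hself, neg_zero]
    rw [hset, Finset.sum_pair hij, hj, inner_neg_left, h1]
    intro h
    exact hi₀ ⟨j, hj, by linarith⟩
  · have hset : ({i | inner ℝ (γ i) (perp (γ i₀)) = 0} : Finset (Fin m)) = {i₀} := by
      ext i
      simp only [Finset.mem_filter, Finset.mem_univ, true_and, Finset.mem_singleton]
      constructor
      · intro h
        rcases eq_or_eq_neg_of_inner_perp_eq_zero (hγ i) (hγ i₀) h with h | h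
        · exact hinj h
        · exact absurd ⟨i, h⟩ hj
      · rintro rfl
        exact hself
    rw [hset, Finset.sum_singleton, h1, mul_one]
    exact hc i₀

lemma analyticAt_inner_right (u ξ : Plane) : AnalyticAt ℝ (fun η : Plane => inner ℝ u η) ξ :=
  (innerSL ℝ u).analyticAt ξ

/-- The symbol of the star transform is invertible at generic frequencies. -/
lemma dense_det_symbol_ne_zero {m : ℕ} {γ : Fin m → Plane} {c : Fin m → ℝ}
    (hγ : ∀ i, ‖γ i‖ = 1) (hinj : Function.Injective γ) (hc : ∀ i, c i ≠ 0)
    (hns : ¬ IsSymmetricStar γ c) :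
    Dense {ξ : Plane | (∀ i, inner ℝ (γ i) ξ ≠ 0) ∧
      (∑ i, (c i * (inner ℝ (γ i) ξ)⁻¹) • frameMatrix (γ i)).det ≠ 0} := by
  obtain ⟨i₀, hi₀⟩ : ∃ i, ¬ ∃ j, γ j = -γ i ∧ c j = c i := by
    by_contra! h
    exact hns (isSymmetricStar_of_forall_exists_neg hγ hinj h)
  set d : ℝ := ∑ i with inner ℝ (γ i) (perp (γ i₀)) = 0, c i * inner ℝ (γ i) (γ i₀) with hd
  have hd0 : d ≠ 0 := sum_parallel_ne_zero hγ hinj hc hi₀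
  set S : Finset (Fin m) := {i | ¬ inner ℝ (γ i) (perp (γ i₀)) = 0} with hS
  set Q : Plane → ℝ := fun ξ => ∏ i ∈ S, inner ℝ (γ i) ξ with hQ
  -- The symbol multiplied by `⟨γ_{i₀}, ξ⟩ Q(ξ)`, which clears all denominators. The branches
  -- parallel to `γ_{i₀}` merge into the first term because `frameMatrix` is even.
  set M : Plane → Matrix (Fin 3) (Fin 3) ℝ := fun ξ => (d * Q ξ) • frameMatrix (γ i₀) +
    ∑ i ∈ S, (c i * inner ℝ (γ i₀) ξ * ∏ j ∈ S.erase i, inner ℝ (γ j) ξ) • frameMatrix (γ i)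
    with hM
  have hMan : AnalyticOnNhd ℝ (fun ξ => (M ξ).det) Set.univ := by
    intro ξ _
    have hent : ∀ k l, AnalyticAt ℝ (fun ξ => M ξ k l) ξ := by
      intro k l
      simp only [hM, hQ, Matrix.add_apply, Matrix.smul_apply, Matrix.sum_apply, smul_eq_mul]
      have hp : ∀ T : Finset (Fin m), AnalyticAt ℝ (fun ξ => ∏ i ∈ T, inner ℝ (γ i) ξ) ξ :=
        fun T => Finset.analyticAt_fun_prod T fun i _ => analyticAt_inner_right _ _
      refine ((analyticAt_const.mul (hp S)).mul analyticAt_const).add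
        (Finset.analyticAt_fun_sum S fun i _ => ?_)
      exact ((analyticAt_const.mul (analyticAt_inner_right _ _)).mul (hp _)).mul analyticAt_const
    simp only [Matrix.det_apply']
    exact Finset.analyticAt_fun_sum _ fun σ _ => analyticAt_const.mul
      (Finset.analyticAt_fun_prod _ fun k _ => hent _ _)
  -- At `ξ = γ_{i₀}^⊥` every non-parallel branch carries the factor `⟨γ_{i₀}, ξ⟩ = 0`, leaving a
  -- nonzero multiple of an invertible matrix.
  have hM0 : (M (perp (γ i₀))).det ≠ 0 := by
    have hself : inner ℝ (γ i₀) (perp (γ i₀)) = 0 := by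
      simp [inner_eq, perp]
      ring
    have hQ0 : Q (perp (γ i₀)) ≠ 0 := Finset.prod_ne_zero_iff.2 fun i hi => by
      simpa [hS] using hi
    have : M (perp (γ i₀)) = (d * Q (perp (γ i₀))) • frameMatrix (γ i₀) := by
      simp [hM, hself]
    rw [this, Matrix.det_smul, det_frameMatrix, sq_add_sq_of_norm_eq_one (hγ i₀)]
    simp [hd0, hQ0]
  have hdense1 := dense_ne_zero_of_analyticOnNhd hMan hM0
  have hopen : ∀ i, IsOpen {ξ : Plane | inner ℝ (γ i) ξ ≠ 0} := fun i =>
    isOpen_ne_fun (by fun_prop) continuous_const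
  have hdense2 : Dense (⋂ i, {ξ : Plane | inner ℝ (γ i) ξ ≠ 0}) := by
    refine dense_iInter_of_isOpen hopen fun i => dense_ne_zero_of_analyticOnNhd
      (fun ξ _ => analyticAt_inner_right _ _) (ξ₀ := γ i) ?_
    rw [real_inner_self_eq_norm_sq, hγ]
    norm_num
  refine (hdense2.inter_of_isOpen_left hdense1 (isOpen_iInter_of_finite hopen)).mono ?_
  rintro ξ ⟨hξ, hdet⟩
  rw [Set.mem_iInter] at hξ
  refine ⟨hξ, fun hN => hdet ?_⟩
  have key : M ξ = (inner ℝ (γ i₀) ξ * Q ξ) •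
      ∑ i, (c i * (inner ℝ (γ i) ξ)⁻¹) • frameMatrix (γ i) := by
    rw [← Finset.sum_filter_add_sum_filter_not Finset.univ
      (fun i => inner ℝ (γ i) (perp (γ i₀)) = 0), smul_add, hM]
    simp only
    congr 1
    · rw [hd, Finset.sum_mul, Finset.sum_smul, Finset.smul_sum]
      refine Finset.sum_congr rfl fun i hi => ?_
      rw [smul_smul]
      have h1 : inner ℝ (γ i₀) (γ i₀) = (1 : ℝ) := by
        rw [real_inner_self_eq_norm_sq, hγ]; norm_num
      have h0 : inner ℝ (γ i₀) ξ ≠ 0 := hξ i₀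
      rcases eq_or_eq_neg_of_inner_perp_eq_zero (hγ i) (hγ i₀) (Finset.mem_filter.1 hi).2
        with h | h
      · rw [h, h1]
        congr 1
        field_simp
      · rw [h, inner_neg_left, inner_neg_left, h1, frameMatrix_neg]
        congr 1
        field_simp
    · rw [Finset.smul_sum]
      refine Finset.sum_congr rfl fun i hi => ?_
      have h0 : inner ℝ (γ i) ξ ≠ 0 := hξ i
      rw [smul_smul, hQ]
      simp only
      rw [← Finset.mul_prod_erase S _ hi]
      congr 1
      field_simp
  change (M ξ).det = 0
  rw [key, Matrix.det_smul, hN, mul_zero]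

/-! ### Injectivity for non-symmetric stars. -/

lemma shiftSymbol_ne_one {ξ v : Plane} (h0 : inner ℝ v ξ ≠ 0) (h1 : |inner ℝ v ξ| < 1) :
    shiftSymbol ξ v ≠ 1 := by
  intro h
  rw [shiftSymbol, Complex.exp_eq_one_iff] at h
  obtain ⟨n, hn⟩ := h
  have hpi : (Real.pi : ℂ) ≠ 0 := by exact_mod_cast Real.pi_ne_zero
  have hn' : inner ℝ v ξ = (n : ℝ) := by
    have : (2 * Real.pi * Complex.I : ℂ) * ((inner ℝ v ξ : ℝ) : ℂ) =
        (2 * Real.pi * Complex.I) * (n : ℂ) := by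
      push_cast at hn
      linear_combination hn
    have := mul_left_cancel₀ (by simp [hpi]) this
    exact_mod_cast this
  rw [hn'] at h0 h1
  have : |n| < 1 := by exact_mod_cast h1
  rw [Int.abs_lt_one_iff] at this
  simp [this] at h0

lemma eq_zero_of_fourier_eq_zero_on_dense {h : Plane → ℂ} (hc : Continuous h) (hi : Integrable h)
    {s : Set Plane} (hs : Dense s) (h0 : ∀ ξ ∈ s, 𝓕 h ξ = 0) : h = 0 := by
  have hF : 𝓕 h = 0 := by
    have hcont : Continuous (𝓕 h) := VectorFourier.fourierIntegral_continuous
      Real.continuous_fourierChar (L := innerₗ Plane) continuous_inner hi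
    exact hcont.ext_on hs continuous_const h0
  rw [← hc.fourierInv_fourier_eq hi (by rw [hF]; exact integrable_zero _ _ _), hF]
  ext x
  simp [Real.fourierInv_eq]

lemma ofReal_divergentBeam (u : Plane) (h : Plane → ℝ) (x : Plane) :
    (divergentBeam u h x : ℂ) = complexBeam u (fun y => (h y : ℂ)) x :=
  integral_ofReal.symm

lemma fourier_sum_mul {ι : Type*} (s : Finset ι) (a : ι → ℂ) (g : ι → Plane → ℂ)
    (hg : ∀ i ∈ s, Integrable (g i)) (ξ : Plane) :
    𝓕 (fun x => ∑ i ∈ s, a i * g i x) ξ = ∑ i ∈ s, a i * 𝓕 (g i) ξ := by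
  simp only [Real.fourier_eq, Finset.smul_sum]
  rw [integral_finsetSum]
  · refine Finset.sum_congr rfl fun i _ => ?_
    rw [← integral_const_mul]
    simp only [mul_smul_comm]
  · intro i hi
    exact (VectorFourier.fourierIntegral_convergent_iff Real.continuous_fourierChar
      (L := innerₗ Plane) continuous_inner ξ).2 ((hg i hi).const_mul (a i))

lemma starTransform_apply {m : ℕ} {γ : Fin m → Plane} (c : Fin m → ℝ) (hγ : ∀ i, γ i ≠ 0)
    {f : TensorField} (hf : ∀ l, Continuous fun x => toVec (f x) l)
    (hs : ∀ l, HasCompactSupport fun x => toVec (f x) l) (x : Plane) (r : Fin 3) :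
    starTransform γ c f x r = ∑ p : Fin m × Fin 3, c p.1 * frameMatrix (γ p.1) r p.2 *
      divergentBeam (γ p.1) (fun y => toVec (f y) p.2) x := by
  have hlin : ∀ (u : Plane), u ≠ 0 → ∀ B, divergentBeam u (fun y => tensorDot (f y) B) x =
      ∑ l, toVec B l * divergentBeam u (fun y => toVec (f y) l) x := by
    intro u hu B
    simp only [divergentBeam, tensorDot, dotProduct, ← integral_const_mul]
    rw [← integral_finsetSum]
    · simp only [mul_comm]
    · intro l _
      exact (integrable_ray (hf l) (hs l) hu x).integrableOn.const_mul _
  rw [Fintype.sum_prod_type, starTransform, Finset.sum_apply]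
  refine Finset.sum_congr rfl fun i _ => ?_
  simp only [hlin _ (hγ i), mul_assoc, ← Finset.mul_sum, Pi.smul_apply, smul_eq_mul]
  congr 1
  fin_cases r <;> rfl

lemma toVec_eq_zero_of_starTransform_eq_zero {m : ℕ} {γ : Fin m → Plane} {c : Fin m → ℝ}
    (hγ : ∀ i, ‖γ i‖ = 1) (hinj : Function.Injective γ) (hc : ∀ i, c i ≠ 0)
    (hns : ¬ IsSymmetricStar γ c) {f : TensorField} (hf : ∀ l, Continuous fun x => toVec (f x) l)
    (hs : ∀ l, HasCompactSupport fun x => toVec (f x) l) (hS : starTransform γ c f = 0)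
    (x : Plane) (l : Fin 3) : toVec (f x) l = 0 := by
  set v : Fin 3 → Plane → ℂ := fun l x => (toVec (f x) l : ℂ) with hv
  have hvc : ∀ l, Continuous (v l) := fun l => Complex.continuous_ofReal.comp (hf l)
  have hvs : ∀ l, HasCompactSupport (v l) := fun l =>
    (hs l).comp_left (g := Complex.ofReal) Complex.ofReal_zero
  have hγ0 : ∀ i, γ i ≠ 0 := fun i h => by simpa [h] using hγ i
  suffices v l = 0 by
    have := congrFun this x
    simpa [hv] using this
  refine eq_zero_of_fourier_eq_zero_on_dense (hvc l)
    ((hvc l).integrable_of_hasCompactSupport (hvs l))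
    (dense_det_symbol_ne_zero hγ hinj hc hns) ?_
  rintro ξ ⟨hξ, hdet⟩
  -- The step length depends on the frequency: it gives `|⟨s γ_i, ξ⟩| < 1`, so no factor `1 -
  -- shiftSymbol ξ (s • γ i)` vanishes.
  set s : ℝ := (‖ξ‖ + 1)⁻¹ with hs_def
  have hs0 : 0 < s := by positivity
  set L : List Plane := List.ofFn fun i => s • γ i with hL
  have hmem : ∀ i, s • γ i ∈ L := fun i => by simp [hL]
  have hsym : ∀ i, shiftSymbol ξ (s • γ i) ≠ 1 := by
    intro i
    apply shiftSymbol_ne_one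
    · rw [real_inner_smul_left]
      exact mul_ne_zero hs0.ne' (hξ i)
    · rw [real_inner_smul_left, abs_mul, abs_of_pos hs0]
      have h1 := abs_real_inner_le_norm (γ i) ξ
      rw [hγ, one_mul] at h1
      rw [hs_def, inv_mul_lt_iff₀ (by positivity)]
      linarith
  set P : ℂ := -(L.map fun v => 1 - shiftSymbol ξ v).prod / (2 * Real.pi * Complex.I) with hP
  have hP0 : P ≠ 0 := by
    refine div_ne_zero (neg_ne_zero.2 (List.prod_ne_zero ?_)) (by simp [Real.pi_ne_zero])
    simp only [hL, List.mem_map, List.mem_ofFn, not_exists, not_and]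
    rintro _ ⟨i, rfl⟩ h
    exact hsym i (sub_eq_zero.1 h).symm
  have hbeam := fun i l => fourier_iterDiff_complexBeam L (hvc l) (hvs l) hs0.le (hmem i) (hξ i)
    (hsym i)
  have hrow : ∀ r, ∑ p : Fin m × Fin 3, ((c p.1 * frameMatrix (γ p.1) r p.2 : ℝ) : ℂ) *
      (P * ((inner ℝ (γ p.1) ξ : ℝ) : ℂ)⁻¹ * 𝓕 (v p.2) ξ) = 0 := by
    intro r
    have h0 : (fun x => ∑ p : Fin m × Fin 3, ((c p.1 * frameMatrix (γ p.1) r p.2 : ℝ) : ℂ) *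
        complexBeam (γ p.1) (v p.2) x) = fun _ => 0 := by
      funext x
      have := starTransform_apply c hγ0 hf hs x r
      rw [hS] at this
      have := congrArg Complex.ofReal this
      rw [Complex.ofReal_sum] at this
      simp only [Complex.ofReal_mul _ (divergentBeam _ _ _), ofReal_divergentBeam] at this
      rw [← this]
      simp
    -- The vanishing combination of beams is differenced before transforming, since now each summand
    -- is integrable and the Fourier transform splits over the sum.
    have h1 : (fun x => ∑ p : Fin m × Fin 3, ((c p.1 * frameMatrix (γ p.1) r p.2 : ℝ) : ℂ) *
        iterDiff L (complexBeam (γ p.1) (v p.2)) x) = fun _ => 0 := by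
      funext x
      rw [← iterDiff_sum, h0, iterDiff_zero]
    have h2 := fourier_sum_mul Finset.univ
      (fun p : Fin m × Fin 3 => ((c p.1 * frameMatrix (γ p.1) r p.2 : ℝ) : ℂ))
      (fun p => iterDiff L (complexBeam (γ p.1) (v p.2))) (fun p _ => (hbeam p.1 p.2).1) ξ
    rw [h1] at h2
    simp only [(hbeam _ _).2] at h2
    rw [← h2]
    simp [Real.fourier_eq]
  set N : Matrix (Fin 3) (Fin 3) ℝ :=
    ∑ i, (c i * (inner ℝ (γ i) ξ)⁻¹) • frameMatrix (γ i) with hN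
  have hdetC : (N.map Complex.ofRealHom).det ≠ 0 := by
    rw [← RingHom.mapMatrix_apply, ← RingHom.map_det]
    simpa using hdet
  refine congrFun (Matrix.eq_zero_of_mulVec_eq_zero hdetC (v := fun l => 𝓕 (v l) ξ) ?_) l
  -- After cancelling `P`, the relations `hrow` say that the symbol `N` annihilates the vector of
  -- Fourier transforms at `ξ`.
  funext r
  refine mul_left_cancel₀ hP0 ?_
  rw [Pi.zero_apply, mul_zero, ← hrow r, Fintype.sum_prod_type_right, Matrix.mulVec, dotProduct,
    Finset.mul_sum]
  refine Finset.sum_congr rfl fun l _ => ?_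
  simp only [hN, Matrix.map_apply, Matrix.sum_apply, Matrix.smul_apply, smul_eq_mul, map_sum,
    Finset.sum_mul, Finset.mul_sum, Complex.ofRealHom_eq_coe]
  refine Finset.sum_congr rfl fun i _ => ?_
  push_cast
  ring

lemma isInvertibleStar_of_not_isSymmetricStar {m : ℕ} {γ : Fin m → Plane} {c : Fin m → ℝ}
    (hγ : ∀ i, ‖γ i‖ = 1) (hinj : Function.Injective γ) (hc : ∀ i, c i ≠ 0)
    (hns : ¬ IsSymmetricStar γ c) (Ω : Set Plane) : IsInvertibleStar γ c Ω := by
  have hγ0 : ∀ i, γ i ≠ 0 := fun i h => by simpa [h] using hγ i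
  have hcont : ∀ f ∈ smoothFields Ω, ∀ l, Continuous fun x => toVec (f x) l := by
    intro f hf l
    fin_cases l <;> exact (hf.2.1 _ _).continuous
  have hsupp : ∀ f ∈ smoothFields Ω, ∀ l, HasCompactSupport fun x => toVec (f x) l := by
    intro f hf l
    refine hf.2.2.1.comp_left (g := fun g => toVec g l) ?_
    fin_cases l <;> rfl
  intro f hf g hg hfg
  have hsub : ∀ x l, toVec ((f - g) x) l = toVec (f x) l - toVec (g x) l := by
    intro x l
    fin_cases l <;> rfl
  have hcont' : ∀ l, Continuous fun x => toVec ((f - g) x) l := by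
    intro l
    simp only [hsub]
    exact (hcont f hf l).sub (hcont g hg l)
  have hsupp' : ∀ l, HasCompactSupport fun x => toVec ((f - g) x) l := by
    intro l
    simp only [hsub]
    exact (hsupp f hf l).sub (hsupp g hg l)
  have hS : starTransform γ c (f - g) = 0 := by
    funext x r
    rw [starTransform_apply c hγ0 hcont' hsupp']
    have h1 := congrFun (congrFun hfg x) r
    rw [starTransform_apply c hγ0 (hcont f hf) (hsupp f hf),
      starTransform_apply c hγ0 (hcont g hg) (hsupp g hg), ← sub_eq_zero,
      ← Finset.sum_sub_distrib] at h1
    rw [Pi.zero_apply, Pi.zero_apply, ← h1]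
    refine Finset.sum_congr rfl fun p _ => ?_
    rw [← mul_sub]
    congr 1
    simp only [hsub]
    exact integral_sub (integrable_ray (hcont f hf _) (hsupp f hf _) (hγ0 _) x).integrableOn
      (integrable_ray (hcont g hg _) (hsupp g hg _) (hγ0 _) x).integrableOn
  have hzero := toVec_eq_zero_of_starTransform_eq_zero hγ hinj hc hns hcont' hsupp' hS
  funext x
  have h := fun l => sub_eq_zero.1 ((hsub x l).symm.trans (hzero x l))
  ext i j
  fin_cases i <;> fin_cases j
  · exact h 0
  · exact h 1
  -- `toVec` omits the lower-left entry, which is recovered from the symmetry of both tensors.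
  · exact ((hf.1 x).apply 0 1).trans ((h 1).trans ((hg.1 x).apply 0 1).symm)
  · exact h 2

end StarTransform

theorem mainTheorem2 (m : ℕ) (γ : Fin m → StarTransform.Plane) (c : Fin m → ℝ)
    (hγ_unit : ∀ i, ‖γ i‖ = 1) (hγ_distinct : Function.Injective γ) (hc : ∀ i, c i ≠ 0)
    (Ω : Set StarTransform.Plane) (hΩ_open : IsOpen Ω) (hΩ_nonempty : Ω.Nonempty) :
    (StarTransform.IsInvertibleStar γ c Ω ↔ ¬ StarTransform.IsSymmetricStar γ c) ∧
      (Odd m → StarTransform.IsInvertibleStar γ c Ω) := by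
  have hinv := fun h => StarTransform.isInvertibleStar_of_not_isSymmetricStar hγ_unit hγ_distinct
    hc h Ω
  refine ⟨⟨fun h hsym => ?_, hinv⟩, fun hodd => hinv ?_⟩
  · exact StarTransform.not_isInvertibleStar_of_isSymmetricStar
      (fun i h0 => by simpa [h0] using hγ_unit i) hΩ_open hΩ_nonempty hsym h
  · rintro ⟨k, rfl, -⟩
    exact Nat.not_even_iff_odd.2 hodd (even_two_mul k)
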